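/- Let $\mathcal Z=\mathcal X\times\mathcal Y$ be a measurable space and $\mathbf Z_1^T=(Z_1,\dots,Z_T)$ a sequence of $\mathcal Z$-valued random variables, where $\mathbf p_t(\cdot\mid z_1^{t-1})$ denotes the (regular) conditional distribution of $Z_t$ given $\mathbf Z_1^{t-1}$, so that $\mathbb E[f(Z_t)\mid \mathbf Z_1^{t-1}]=\int f\,d\mathbf p_t(\cdot\mid \mathbf Z_1^{t-1})$. Let $L:\mathcal Y\times\mathcal Y\to[0,\infty)$ be a loss function, $H$ a nonempty set of maps $h:\mathcal X\to\mathcal Y$, and $\mathcal F=\{(x,y)\mapsto L(h(x),y): h\in H\}$. Assume that $|f|\le M$ for all $f\in\mathcal F$, and that $\mathcal F$ is a measurable class: each $f\in\mathcal F$ is measurable, and for all $n$ and $a\in\mathbb R^n$ the function $(z_1,\dots,z_n)\mapsto\sup_{f\in\mathcal F}\sum_i a_i f(z_i)$ is universally measurable. Random trees. A complete binary tree $\mathbf z$ of depth $T$ is a sequence of maps $z_t:\{\pm1\}^{t-1}\to\mathcal Z$, $1\le t\le T$; write $z_t(\sigma)=z_t(\sigma_1,\dots,\sigma_{t-1})$.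 The law $T(\mathbf p)$ of a random tree is defined as follows: at the node reached by $(\sigma_1,\dots,\sigma_{t-1})$ draw $Z_t,Z_t'$ independently from $\mathbf p_t(\cdot\mid S_1(\sigma_1),\dots,S_{t-1}(\sigma_{t-1}))$, where $S_r(1)=Z_r$ and $S_r(-1)=Z'_r$ are the draws at the preceding nodes of the path and draws at different nodes are otherwise independent; label the node by $Z_t$. Covering numbers. Let $w\in\mathbb R^T$. A set $V$ of real-valued trees of depth $T$ is a sequential $\alpha$-cover of $\mathcal F$ on $\mathbf z$ with respect to the $w$-weighted $\ell_1$ norm if for all $f\in\mathcal F$ and $\sigma\in\{\pm1\}^T$ there is $v\in V$ with $\|w\|_\infty\sum_{t=1}^T|v_t(\sigma)-f(z_t(\sigma))|\le\alpha$. Let $\mathcal N_1(\alpha,\mathcal F,\mathbf z)\in\mathbb N\cup\{\infty\}$ be the minimal cardinality of such a cover. Theorem. Let $1\le s\le T$, let $p$ be the uniform distribution over the last $s$ points ($p_t=1/s$ for $T-s<t\le T$ and $p_t=0$ otherwise), let $q\in\mathbb R^T$, and let the weights of the covers be $w=p-q$. Then for any $\delta>0$, with probability at least $1-\delta$, the following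 holds for all $\alpha>0$ with $\mathbb E_{\mathbf z\sim T(\mathbf p)}[\mathcal N_1(\alpha,\mathcal F,\mathbf z)]<\infty$: $$\sup_{f\in\mathcal F}\sum_{t=1}^T(p_t-q_t)\,\mathbb E[f(Z_t)\mid\mathbf Z_1^{t-1}]\ \le\ \sup_{f\in\mathcal F}\sum_{t=1}^T(p_t-q_t)f(Z_t)+2\alpha+M\|q-p\|_2\sqrt{2\log\frac{\mathbb E_{\mathbf z\sim T(\mathbf p)}[\mathcal N_1(\alpha,\mathcal F,\mathbf z)]}{\delta}}.$$ (For $\alpha$ with infinite expected covering number the right-hand side is understood as $+\infty$.) -/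

import Mathlib

open MeasureTheory ProbabilityTheory
open scoped ENNReal

/-! ### Complete binary trees -/

universe u

/-- Complete binary trees of depth `n` with labels in `A`: a root label, the subtree entered
by the sign `+1` and the subtree entered by the sign `-1`. -/
def BinTree (A : Type u) : ℕ → Type u
  | 0 => PUnit
  | n + 1 => A × BinTree A n × BinTree A n

/-- The product σ-algebra on the labels of a tree. -/
instance BinTree.instMeasurableSpace (A : Type*) [MeasurableSpace A] :
    (n : ℕ) → MeasurableSpace (BinTree A n)
  | 0 => inferInstanceAs (MeasurableSpace PUnit)
  | n + 1 =>
    letI := BinTree.instMeasurableSpace A n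
    inferInstanceAs (MeasurableSpace (A × BinTree A n × BinTree A n))

/-- `z.label σ t` is the label `z_t(σ)` met at level `t` along the path `σ`, where `true` stands
for `+1` and `false` for `-1`. It depends only on the signs `σ i` with `i < t`. -/
def BinTree.label {A : Type*} : {n : ℕ} → BinTree A n → (Fin n → Bool) → Fin n → A
  | 0, _, _ => Fin.elim0
  | n + 1, z, σ =>
    Fin.cons (show A × BinTree A n × BinTree A n from z).1
      (if σ 0 then
        BinTree.label (show A × BinTree A n × BinTree A n from z).2.1 (Fin.tail σ)
      else
        BinTree.label (show A × BinTree A n × BinTree A n from z).2.2 (Fin.tail σ))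

/-! ### Sequential covering numbers -/

/-- `V` is a sequential `α`-cover of `G` on the tree `z` with respect to the `w`-weighted
`ℓ₁` norm. Here `‖w‖ = max_t |w_t|` is the dual norm; the condition
`∑_t |v_t(σ) - g(z_t(σ))| ≤ ‖w‖⁻¹ α` is written without division. -/
def IsSeqCover {A : Type*} {T : ℕ} (w : Fin T → ℝ) (α : ℝ) (G : Set (A → ℝ)) (z : BinTree A T)
    (V : Set (BinTree ℝ T)) : Prop :=
  ∀ g ∈ G, ∀ σ : Fin T → Bool, ∃ v ∈ V,
    ‖w‖ * ∑ t, |v.label σ t - g (z.label σ t)| ≤ α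

/-- The sequential covering number `N₁(α, G, z)` (with weights `w`): the least size of a cover,
`⊤` if there is no finite one. -/
noncomputable def seqCoveringNumber {A : Type*} {T : ℕ} (w : Fin T → ℝ) (α : ℝ)
    (G : Set (A → ℝ)) (z : BinTree A T) : ℕ∞ :=
  ⨅ (V : Set (BinTree ℝ T)) (_ : IsSeqCover w α G z V), V.encard

/-! ### The law of the random tree generated by a process -/

lemma measurable_finSnoc {A : Type*} [MeasurableSpace A] (k : ℕ) :
    Measurable fun p : (Fin k → A) × A => (Fin.snoc p.1 p.2 : Fin (k + 1) → A) := by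
  refine measurable_pi_lambda _ fun i => ?_
  refine Fin.lastCases ?_ (fun j => ?_) i
  · simpa using measurable_snd
  · simp only [Fin.snoc_castSucc]
    exact (measurable_pi_apply j).comp measurable_fst

/-- Law of the root label and the two subtrees, given a history of length `k`: draw `Z, Z'`
independently from `κ (· | history)`, take `Z` as the root label, and then, independently, draw the
`+1` subtree from `η` at the history extended by `Z` and the `-1` subtree from `η` at the history
extended by `Z'`. -/
noncomputable def treeStep {A B : Type*} [MeasurableSpace A] [MeasurableSpace B] {k : ℕ}
    (κ : Kernel (Fin k → A) A) (η : Kernel (Fin (k + 1) → A) B) :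
    Kernel (Fin k → A) (A × B × B) :=
  Kernel.snd ((κ ×ₖ κ) ⊗ₖ
    (Kernel.deterministic (fun x : (Fin k → A) × (A × A) => x.2.1)
        (measurable_fst.comp measurable_snd) ×ₖ
      (η.comap (fun x : (Fin k → A) × (A × A) => (Fin.snoc x.1 x.2.1 : Fin (k + 1) → A))
          ((measurable_finSnoc k).comp
            (measurable_fst.prodMk (measurable_fst.comp measurable_snd))) ×ₖ
        η.comap (fun x : (Fin k → A) × (A × A) => (Fin.snoc x.1 x.2.2 : Fin (k + 1) → A))
          ((measurable_finSnoc k).comp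
            (measurable_fst.prodMk (measurable_snd.comp measurable_snd))))))

instance treeStep.instIsMarkovKernel {A B : Type*} [MeasurableSpace A] [MeasurableSpace B] {k : ℕ}
    (κ : Kernel (Fin k → A) A) [IsMarkovKernel κ] (η : Kernel (Fin (k + 1) → A) B)
    [IsMarkovKernel η] : IsMarkovKernel (treeStep κ η) := by
  unfold treeStep
  infer_instance

/-- Given the conditional distributions `p k (· | history)` of a process, the law of a random
tree of depth `n` grown from a history of length `k`. -/
noncomputable def treeKernel {A : Type*} [MeasurableSpace A]
    (p : (k : ℕ) → Kernel (Fin k → A) A) :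
    (n k : ℕ) → Kernel (Fin k → A) (BinTree A n)
  | 0, k => Kernel.const (Fin k → A) (Measure.dirac (PUnit.unit : BinTree A 0))
  | n + 1, k => treeStep (p k) (treeKernel p n (k + 1))

instance treeKernel.instIsMarkovKernel {A : Type*} [MeasurableSpace A]
    (p : (k : ℕ) → Kernel (Fin k → A) A) [∀ k, IsMarkovKernel (p k)] (n k : ℕ) :
    IsMarkovKernel (treeKernel p n k) := by
  induction n generalizing k with
  | zero => exact ⟨fun _ => Measure.dirac.isProbabilityMeasure⟩
  | succ n ih =>
    have := ih (k + 1)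
    exact treeStep.instIsMarkovKernel (p k) (treeKernel p n (k + 1))

/-- The law `T(p)` of the random tree of depth `T` generated by the process. -/
noncomputable def treeLaw {A : Type*} [MeasurableSpace A]
    (p : (k : ℕ) → Kernel (Fin k → A) A) (T : ℕ) : Measure (BinTree A T) :=
  treeKernel p T 0 Fin.elim0

/-- The expected sequential covering number `E_{z ∼ T(p)} N₁(α, G, z)` (with weights `w`). -/
noncomputable def expectedSeqCoveringNumber {A : Type*} [MeasurableSpace A]
    (p : (k : ℕ) → Kernel (Fin k → A) A) {T : ℕ} (w : Fin T → ℝ) (α : ℝ) (G : Set (A → ℝ)) :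
    ℝ≥0∞ :=
  ∫⁻ z, (seqCoveringNumber w α G z : ℝ≥0∞) ∂(treeLaw p T)

/-! ### Loss class, measurability, weights, past of a process -/

/-- The family of functions `(x, y) ↦ L (h x, y)`, `h ∈ H`. -/
def lossClass {X Y : Type*} (L : Y → Y → ℝ) (H : Set (X → Y)) : Set (X × Y → ℝ) :=
  (fun h z => L (h z.1) z.2) '' H

/-- The usual measurability requirement on a class of functions in empirical process theory:
its members are measurable, and so, up to completion, are the suprema of their weighted sums
over finitely many points. -/
structure IsMeasurableClass {A : Type*} [MeasurableSpace A] (F : Set (A → ℝ)) : Prop where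
  measurable : ∀ f ∈ F, Measurable f
  aemeasurable_iSup : ∀ (n : ℕ) (a : Fin n → ℝ) (ν : Measure (Fin n → A)),
    IsProbabilityMeasure ν → AEMeasurable (fun x => ⨆ f : F, ∑ i, a i * f.1 (x i)) ν

/-- The uniform distribution over the last `s` of `T` points. -/
noncomputable def uniformLast (T s : ℕ) (t : Fin T) : ℝ :=
  if T ≤ (t : ℕ) + s then 1 / (s : ℝ) else 0

/-- The observations preceding time `t`. -/
def past {Ω A : Type*} {T : ℕ} (Z : Fin T → Ω → A) (t : Fin T) (ω : Ω) : Fin (t : ℕ) → A :=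
  fun i => Z (Fin.castLE t.isLt.le i) ω

/-! Put `w = p - q`. It suffices to bound `∑ w_t (E[f(Z_t) | past] - f(Z_t))` uniformly over `f`,
since the supremum of a sum is at most the sum of the suprema. The bound comes from an exponential
moment and Markov's inequality.

Given the whole sequence `Z`, draw an independent tangent point `Z'_t` from each conditional law
along the observed history (`tangentKernel`). Jensen's inequality replaces the conditional
expectations by `f(Z'_t)`. For each sign path `σ`, let `X_σ` be the sum, with coefficients `-w_t
σ_t`, of `f - M/2` at the points chosen by `σ` among `Z_t`, `Z'_t`. The tangent difference is `X_σ +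
X_{-σ}`, so AM-GM bounds its exponential by an average over `σ` of `exp(2 l X_σ)`
(`ofReal_exp_sub_le_sum_expSup`). For fixed `σ` the chosen points have the law of the labels met
along `σ` in the random tree (`lintegral_signSelect_tangentKernel`).

On a fixed tree the supremum over the class is at most a sum over a finite cover, and each cover
element obeys Hoeffding's bound for Rademacher sums along tree paths (`sum_expSup_label_le`). Values
in `[0, M]` recentred at `M / 2` are at most `M / 2` in size, which offsets the factor 2 from AM-GM.
Optimizing `l` gives the bound at one scale `α`. All scales hold at once because the bad events are
nested (`measure_exists_lt_le_of_forall`). -/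

/-! ### Integration against the law of the random tree, and paths in it. -/

lemma lintegral_treeStep {A B : Type*} [MeasurableSpace A] [MeasurableSpace B] {k : ℕ}
    (κ : Kernel (Fin k → A) A) [IsMarkovKernel κ] (η : Kernel (Fin (k + 1) → A) B)
    [IsMarkovKernel η] (h : Fin k → A) {g : A × B × B → ℝ≥0∞} (hg : Measurable g) :
    ∫⁻ y, g y ∂treeStep κ η h =
      ∫⁻ x, ∫⁻ x', ∫⁻ l, ∫⁻ r, g (x, l, r) ∂η (Fin.snoc h x') ∂η (Fin.snoc h x) ∂κ h ∂κ h := by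
  rw [treeStep, Kernel.snd_eq, Kernel.map_apply _ measurable_snd,
    lintegral_map hg measurable_snd,
    Kernel.lintegral_compProd _ _ _ (f := fun a : (A × A) × A × B × B => g a.2)
      (hg.comp measurable_snd),
    Kernel.lintegral_prod]
  swap
  · exact (Measurable.lintegral_kernel_prod_right' (hg.comp measurable_snd)).comp
      measurable_prodMk_left
  refine lintegral_congr fun x => lintegral_congr fun x' => ?_
  rw [Kernel.lintegral_prod _ _ _ (by fun_prop),
    Kernel.lintegral_deterministic' _
      (Measurable.lintegral_prod_right' (f := fun p : A × B × B => g p) hg),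
    Kernel.lintegral_prod _ _ _ (by fun_prop)]
  simp only [Kernel.comap_apply]

lemma lintegral_treeKernel_succ {A : Type*} [MeasurableSpace A]
    (P : (k : ℕ) → Kernel (Fin k → A) A) [∀ k, IsMarkovKernel (P k)] (n k : ℕ)
    (h : Fin k → A) {g : A × BinTree A n × BinTree A n → ℝ≥0∞} (hg : Measurable g) :
    ∫⁻ z : BinTree A (n + 1), g z ∂treeKernel P (n + 1) k h =
      ∫⁻ x, ∫⁻ x', ∫⁻ l, ∫⁻ r, g (x, l, r) ∂treeKernel P n (k + 1) (Fin.snoc h x')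
        ∂treeKernel P n (k + 1) (Fin.snoc h x) ∂P k h ∂P k h :=
  lintegral_treeStep (P k) (treeKernel P n (k + 1)) h hg

lemma measurable_finCons {A : Type*} [MeasurableSpace A] (n : ℕ) :
    Measurable fun p : A × (Fin n → A) => (Fin.cons p.1 p.2 : Fin (n + 1) → A) := by
  refine measurable_pi_lambda _ fun i => ?_
  refine Fin.cases ?_ (fun j => ?_) i
  · simpa using measurable_fst
  · simp only [Fin.cons_succ]
    exact (measurable_pi_apply j).comp measurable_snd

lemma BinTree.label_succ {A : Type*} {n : ℕ} (x : A) (l r : BinTree A n)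
    (σ : Fin (n + 1) → Bool) :
    BinTree.label (n := n + 1) (x, l, r) σ =
      Fin.cons x (if σ 0 then l.label (Fin.tail σ) else r.label (Fin.tail σ)) := rfl

lemma BinTree.measurable_label {A : Type*} [MeasurableSpace A] {n : ℕ} (σ : Fin n → Bool) :
    Measurable fun z : BinTree A n => z.label σ := by
  induction n with
  | zero => exact measurable_pi_lambda _ fun i => i.elim0
  | succ n ih =>
    have h : Measurable fun z : A × BinTree A n × BinTree A n =>
        (Fin.cons z.1 (if σ 0 then z.2.1.label (Fin.tail σ) else z.2.2.label (Fin.tail σ)) :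
          Fin (n + 1) → A) := by
      refine (measurable_finCons n).comp (measurable_fst.prodMk ?_)
      cases σ 0
      · exact (ih _).comp (measurable_snd.comp measurable_snd)
      · exact (ih _).comp (measurable_fst.comp measurable_snd)
    exact h

/-- Along the signs `σ`, keep the observation `y` at `true` and the tangent draw `y'` at
`false`. -/
def signSelect {A : Type*} {n : ℕ} (σ : Fin n → Bool) (y y' : Fin n → A) : Fin n → A :=
  fun i => if σ i then y i else y' i

lemma measurable_signSelect {A : Type*} [MeasurableSpace A] {n : ℕ} (σ : Fin n → Bool) :
    Measurable fun p : (Fin n → A) × (Fin n → A) => signSelect σ p.1 p.2 := by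
  refine measurable_pi_lambda _ fun i => ?_
  unfold signSelect
  cases σ i
  · exact (measurable_pi_apply i).comp measurable_snd
  · exact (measurable_pi_apply i).comp measurable_fst

lemma signSelect_cons {A : Type*} {n : ℕ} (σ : Fin (n + 1) → Bool) (y : Fin (n + 1) → A) (a : A)
    (x : Fin n → A) :
    signSelect σ y (Fin.cons a x) =
      Fin.cons (if σ 0 then y 0 else a) (signSelect (Fin.tail σ) (Fin.tail y) x) := by
  funext i
  refine Fin.cases ?_ (fun j => ?_) i
  · simp [signSelect]
  · simp only [signSelect, Fin.cons_succ, Fin.tail]; rfl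

/-! ### The decoupled tangent sequence -/

/-- The first `k` observations. -/
def history {Ω A : Type*} (Z : ℕ → Ω → A) (k : ℕ) (ω : Ω) : Fin k → A := fun i => Z i ω

lemma history_succ {Ω A : Type*} (Z : ℕ → Ω → A) (k : ℕ) (ω : Ω) :
    history Z (k + 1) ω = Fin.snoc (history Z k ω) (Z k ω) := by
  funext i
  refine Fin.lastCases ?_ (fun j => ?_) i <;> simp [history]

lemma measurable_history {Ω A : Type*} [MeasurableSpace Ω] [MeasurableSpace A] {Z : ℕ → Ω → A}
    (hZ : ∀ i, Measurable (Z i)) (k : ℕ) : Measurable (history Z k) :=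
  measurable_pi_lambda _ fun i => hZ i

/-- Given `ω`, the law of independent draws from the conditional distributions
`P (k + i) (· | history)`, `i < n`. -/
noncomputable def tangentKernel {Ω A : Type*} [MeasurableSpace Ω] [MeasurableSpace A]
    (P : (k : ℕ) → Kernel (Fin k → A) A) (Z : ℕ → Ω → A) (hZ : ∀ i, Measurable (Z i)) :
    (n k : ℕ) → Kernel Ω (Fin n → A)
  | 0, _ => Kernel.const Ω (Measure.dirac Fin.elim0)
  | n + 1, k =>
    ((P k).comap (history Z k) (measurable_history hZ k) ×ₖ tangentKernel P Z hZ n (k + 1)).map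
      fun p => Fin.cons p.1 p.2

section Tangent

variable {Ω A : Type*} [MeasurableSpace Ω] [MeasurableSpace A]
  (P : (k : ℕ) → Kernel (Fin k → A) A) [∀ k, IsMarkovKernel (P k)]
  (Z : ℕ → Ω → A) (hZ : ∀ i, Measurable (Z i))

instance tangentKernel.instIsMarkovKernel (n k : ℕ) :
    IsMarkovKernel (tangentKernel P Z hZ n k) := by
  induction n generalizing k with
  | zero => exact ⟨fun _ => Measure.dirac.isProbabilityMeasure⟩
  | succ n ih =>
    have := ih (k + 1)
    exact Kernel.IsMarkovKernel.map _ (measurable_finCons n)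

lemma lintegral_tangentKernel_zero (k : ℕ) (ω : Ω) (g : (Fin 0 → A) → ℝ≥0∞) :
    ∫⁻ x, g x ∂tangentKernel P Z hZ 0 k ω = g Fin.elim0 := by
  have : g = fun _ => g Fin.elim0 := funext fun x => congrArg g (Subsingleton.elim _ _)
  rw [this]
  simp

lemma lintegral_tangentKernel_succ (n k : ℕ) (ω : Ω) {g : (Fin (n + 1) → A) → ℝ≥0∞}
    (hg : Measurable g) :
    ∫⁻ x, g x ∂tangentKernel P Z hZ (n + 1) k ω =
      ∫⁻ a, ∫⁻ x, g (Fin.cons a x) ∂tangentKernel P Z hZ n (k + 1) ω ∂P k (history Z k ω) := by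
  rw [tangentKernel, Kernel.map_apply _ (measurable_finCons n),
    lintegral_map hg (measurable_finCons n),
    Kernel.lintegral_prod _ _ _ (g := fun p : A × (Fin n → A) => g (Fin.cons p.1 p.2))
      (hg.comp (measurable_finCons n)), Kernel.comap_apply]

lemma lintegral_condDistrib {μ : Measure Ω} [IsProbabilityMeasure μ] {B C : Type*}
    [MeasurableSpace B] [MeasurableSpace C] {X : Ω → B} {Y : Ω → C} {κ : Kernel B C}
    [IsMarkovKernel κ] (hX : Measurable X) (hY : Measurable Y)
    (h : HasCondDistrib Y X κ μ) {g : B → C → ℝ≥0∞} (hg : Measurable (Function.uncurry g)) :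
    ∫⁻ ω, g (X ω) (Y ω) ∂μ = ∫⁻ ω, ∫⁻ y, g (X ω) y ∂κ (X ω) ∂μ := by
  have h1 := h.map_eq
  have h2 : ∫⁻ p, Function.uncurry g p ∂(μ.map fun ω => (X ω, Y ω)) =
      ∫⁻ ω, g (X ω) (Y ω) ∂μ := lintegral_map hg (hX.prodMk hY)
  rw [← h2, h1, Measure.lintegral_compProd hg,
    lintegral_map (Measurable.lintegral_kernel_prod_right' hg) hX]
  rfl

/-- In the tree, the draw that extends the history plays the role of the observation. At a `+1` step
it is also the label; at a `-1` step the label is the other, independent draw, that is, the tangent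
point. So labels along `σ` and selected points agree in law, jointly with the history. -/
lemma lintegral_signSelect_tangentKernel {μ : Measure Ω} [IsProbabilityMeasure μ] {T : ℕ}
    (hP : ∀ k < T, HasCondDistrib (Z k) (history Z k) (P k) μ) (n k : ℕ) (hnk : k + n ≤ T)
    (σ : Fin n → Bool) {g : (Fin k → A) → (Fin n → A) → ℝ≥0∞}
    (hg : Measurable (Function.uncurry g)) :
    ∫⁻ ω, ∫⁻ x, g (history Z k ω) (signSelect σ (fun i => Z (k + i) ω) x)
        ∂tangentKernel P Z hZ n k ω ∂μ =
      ∫⁻ ω, ∫⁻ z, g (history Z k ω) (BinTree.label z σ) ∂treeKernel P n k (history Z k ω) ∂μ := by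
  induction n generalizing k with
  | zero =>
    refine lintegral_congr fun ω => ?_
    rw [lintegral_tangentKernel_zero]
    have : ∀ z : BinTree A 0, g (history Z k ω) (BinTree.label z σ) =
        g (history Z k ω) (signSelect σ (fun i => Z (k + i) ω) Fin.elim0) :=
      fun z => congrArg _ (Subsingleton.elim _ _)
    simp_rw [this]
    simp
  | succ n ih =>
    have hinit : Measurable fun h : Fin (k + 1) → A => (Fin.init h : Fin k → A) :=
      measurable_pi_lambda _ fun i => measurable_pi_apply _
    have key : ∀ ω, ∫⁻ x, g (history Z k ω) (signSelect σ (fun i => Z (k + i) ω) x)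
          ∂tangentKernel P Z hZ (n + 1) k ω =
        ∫⁻ a, ∫⁻ x, g (history Z k ω) (Fin.cons (if σ 0 then Z k ω else a)
          (signSelect (Fin.tail σ) (fun i => Z (k + 1 + i) ω) x))
            ∂tangentKernel P Z hZ n (k + 1) ω ∂P k (history Z k ω) := by
      intro ω
      rw [lintegral_tangentKernel_succ]
      · refine lintegral_congr fun a => lintegral_congr fun x => ?_
        rw [signSelect_cons]
        have h2 : (Fin.tail fun i : Fin (n + 1) => Z (k + i) ω) =
            fun i : Fin n => Z (k + 1 + i) ω := by
          funext i; simp [Fin.tail]; congr 1; omega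
        rw [h2]; rfl
      · exact hg.comp (measurable_const.prodMk
          ((measurable_signSelect σ).comp measurable_prodMk_left))
    have tree : ∀ ω, ∫⁻ z, g (history Z k ω) (BinTree.label z σ)
          ∂treeKernel P (n + 1) k (history Z k ω) =
        ∫⁻ x, ∫⁻ x', ∫⁻ l, ∫⁻ r, g (history Z k ω)
          (Fin.cons x (if σ 0 then l.label (Fin.tail σ) else r.label (Fin.tail σ)))
          ∂treeKernel P n (k + 1) (Fin.snoc (history Z k ω) x')
          ∂treeKernel P n (k + 1) (Fin.snoc (history Z k ω) x) ∂P k (history Z k ω)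
          ∂P k (history Z k ω) := by
      intro ω
      exact lintegral_treeKernel_succ P n k (history Z k ω)
        (g := fun z => g (history Z k ω) (BinTree.label (n := n + 1) z σ))
        (hg.comp (measurable_const.prodMk (BinTree.measurable_label σ)))
    simp_rw [key, tree]
    cases hσ : σ 0
    · simp only [Bool.false_eq_true, if_false, lintegral_const, measure_univ, mul_one]
      -- Sign `-1`: the selected point is the tangent draw `a`, independent of the later tangent
      -- draws given `ω`. Integrating it innermost leaves a function of the extended history, to
      -- which the induction hypothesis applies.
      have swap : ∀ ω, ∫⁻ a, ∫⁻ x, g (history Z k ω) (Fin.cons a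
            (signSelect (Fin.tail σ) (fun i => Z (k + 1 + i) ω) x))
            ∂tangentKernel P Z hZ n (k + 1) ω ∂P k (history Z k ω) =
          ∫⁻ x, ∫⁻ a, g (history Z k ω) (Fin.cons a
            (signSelect (Fin.tail σ) (fun i => Z (k + 1 + i) ω) x))
            ∂P k (history Z k ω) ∂tangentKernel P Z hZ n (k + 1) ω := by
        intro ω
        refine lintegral_lintegral_swap (Measurable.aemeasurable ?_)
        exact hg.comp (measurable_const.prodMk ((measurable_finCons n).comp
          (measurable_fst.prodMk ((measurable_signSelect _).comp
            (measurable_const.prodMk measurable_snd)))))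
      simp_rw [swap]
      have hG : Measurable (Function.uncurry fun (h : Fin (k + 1) → A) (x : Fin n → A) =>
          ∫⁻ a, g (Fin.init h) (Fin.cons a x) ∂P k (Fin.init h)) := by
        have h1 : Measurable fun q : ((Fin (k + 1) → A) × (Fin n → A)) × A =>
            g (Fin.init q.1.1) (Fin.cons q.2 q.1.2) :=
          hg.comp ((hinit.comp (measurable_fst.comp measurable_fst)).prodMk
            ((measurable_finCons n).comp
              (measurable_snd.prodMk (measurable_snd.comp measurable_fst))))
        exact Measurable.lintegral_kernel_prod_right'
          (κ := (P k).comap (fun q : (Fin (k + 1) → A) × (Fin n → A) => Fin.init q.1)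
            (hinit.comp measurable_fst)) h1
      have h3 := ih (k + 1) (by omega) (Fin.tail σ) hG
      simp only [history_succ, Fin.init_snoc] at h3
      rw [h3]
      have hH : Measurable (Function.uncurry fun (h : Fin k → A) (y : A) =>
          ∫⁻ z : BinTree A n, ∫⁻ a, g h (Fin.cons a (z.label (Fin.tail σ))) ∂P k h
            ∂treeKernel P n (k + 1) (Fin.snoc h y)) := by
        have h1 : Measurable fun q : (((Fin k → A) × A) × BinTree A n) × A =>
            g q.1.1.1 (Fin.cons q.2 (q.1.2.label (Fin.tail σ))) :=
          hg.comp ((measurable_fst.comp (measurable_fst.comp measurable_fst)).prodMk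
            ((measurable_finCons n).comp (measurable_snd.prodMk
              ((BinTree.measurable_label _).comp (measurable_snd.comp measurable_fst)))))
        have h2 := Measurable.lintegral_kernel_prod_right'
          (κ := (P k).comap (fun q : ((Fin k → A) × A) × BinTree A n => q.1.1)
            (measurable_fst.comp measurable_fst)) h1
        exact Measurable.lintegral_kernel_prod_right'
          (κ := (treeKernel P n (k + 1)).comap
            (fun q : (Fin k → A) × A => (Fin.snoc q.1 q.2 : Fin (k + 1) → A))
            (measurable_finSnoc k)) h2
      -- The observation becomes a fresh draw `y`, which is the `x'` of the tree; two exchanges of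
      -- integrals then move the label draw `a` outermost.
      rw [lintegral_condDistrib (measurable_history hZ k) (hZ k) (hP k (by omega)) hH]
      refine lintegral_congr fun ω => ?_
      have hinner : ∀ y : A, ∫⁻ z : BinTree A n, ∫⁻ a, g (history Z k ω)
            (Fin.cons a (z.label (Fin.tail σ))) ∂P k (history Z k ω)
            ∂treeKernel P n (k + 1) (Fin.snoc (history Z k ω) y) =
          ∫⁻ a, ∫⁻ z : BinTree A n, g (history Z k ω)
            (Fin.cons a (z.label (Fin.tail σ)))
            ∂treeKernel P n (k + 1) (Fin.snoc (history Z k ω) y) ∂P k (history Z k ω) := by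
        intro y
        refine lintegral_lintegral_swap (Measurable.aemeasurable ?_)
        exact hg.comp (measurable_const.prodMk ((measurable_finCons n).comp
          (measurable_snd.prodMk ((BinTree.measurable_label _).comp measurable_fst))))
      simp_rw [hinner]
      refine lintegral_lintegral_swap (Measurable.aemeasurable ?_)
      have h1 : Measurable fun q : (A × A) × BinTree A n =>
          g (history Z k ω) (Fin.cons q.1.2 (q.2.label (Fin.tail σ))) :=
        hg.comp (measurable_const.prodMk ((measurable_finCons n).comp
          ((measurable_snd.comp measurable_fst).prodMk
            ((BinTree.measurable_label _).comp measurable_snd))))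
      exact Measurable.lintegral_kernel_prod_right'
        (κ := (treeKernel P n (k + 1)).comap
          (fun q : A × A => (Fin.snoc (history Z k ω) q.1 : Fin (k + 1) → A))
          ((measurable_finSnoc k).comp
            (measurable_const (a := history Z k ω) |>.prodMk measurable_fst))) h1
    · simp only [if_true, lintegral_const, measure_univ, mul_one]
      -- Sign `+1`: the observation is both the label and the last entry of the extended history.
      have hG : Measurable (Function.uncurry fun (h : Fin (k + 1) → A) (x : Fin n → A) =>
          g (Fin.init h) (Fin.cons (h (Fin.last k)) x)) :=
        hg.comp ((hinit.comp measurable_fst).prodMk ((measurable_finCons n).comp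
          (((measurable_pi_apply _).comp measurable_fst).prodMk measurable_snd)))
      have h3 := ih (k + 1) (by omega) (Fin.tail σ) hG
      simp only [history_succ, Fin.init_snoc, Fin.snoc_last] at h3
      rw [h3]
      have hH : Measurable (Function.uncurry fun (h : Fin k → A) (y : A) =>
          ∫⁻ z : BinTree A n, g h (Fin.cons y (z.label (Fin.tail σ)))
            ∂treeKernel P n (k + 1) (Fin.snoc h y)) := by
        have h1 : Measurable fun q : ((Fin k → A) × A) × BinTree A n =>
            g q.1.1 (Fin.cons q.1.2 (q.2.label (Fin.tail σ))) :=
          hg.comp ((measurable_fst.comp measurable_fst).prodMk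
            ((measurable_finCons n).comp ((measurable_snd.comp measurable_fst).prodMk
              ((BinTree.measurable_label _).comp measurable_snd))))
        exact Measurable.lintegral_kernel_prod_right'
          (κ := (treeKernel P n (k + 1)).comap
            (fun q : (Fin k → A) × A => (Fin.snoc q.1 q.2 : Fin (k + 1) → A))
            (measurable_finSnoc k)) h1
      exact lintegral_condDistrib (measurable_history hZ k) (hZ k) (hP k (by omega)) hH

/-! ### Jensen's inequality for tangent draws. -/

/-- Integrate the supporting line `exp m * (u - m + 1) ≤ exp u` at the mean `m`. Integrability of
the exponential is not needed. -/
lemma ofReal_exp_integral_le (ν : Measure A) [IsProbabilityMeasure ν] {f : A → ℝ}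
    (hf : Integrable f ν) (b c : ℝ) :
    ENNReal.ofReal (Real.exp (b * ∫ x, f x ∂ν + c)) ≤
      ∫⁻ x, ENNReal.ofReal (Real.exp (b * f x + c)) ∂ν := by
  set m := b * ∫ x, f x ∂ν + c with hm
  have hI : Integrable (fun x => Real.exp m * (b * f x + c - m + 1)) ν := by fun_prop
  have h1 : ∫ x, Real.exp m * (b * f x + c - m + 1) ∂ν = Real.exp m := by
    have : ∀ x, Real.exp m * (b * f x + c - m + 1) =
        Real.exp m * b * f x + Real.exp m * (c - m + 1) := fun x => by ring
    simp_rw [this]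
    rw [integral_add (by fun_prop) (by fun_prop), integral_const_mul, integral_const]
    simp only [probReal_univ, one_smul]
    rw [hm]; ring
  calc ENNReal.ofReal (Real.exp m)
      = ENNReal.ofReal (∫ x, Real.exp m * (b * f x + c - m + 1) ∂ν) := by rw [h1]
    _ ≤ ∫⁻ x, ENNReal.ofReal (Real.exp m * (b * f x + c - m + 1)) ∂ν :=
        (ENNReal.ofReal_le_ofReal (integral_mono hI hI.pos_part fun x => le_max_left _ _)).trans
          (by
            rw [ofReal_integral_eq_lintegral_ofReal hI.pos_part
              (Filter.Eventually.of_forall fun x => le_max_right _ _)]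
            exact lintegral_mono fun x => by
              rcases le_total (Real.exp m * (b * f x + c - m + 1)) 0 with h | h <;> simp [h])
    _ ≤ _ := by
        refine lintegral_mono fun x => ENNReal.ofReal_le_ofReal ?_
        calc Real.exp m * (b * f x + c - m + 1)
            ≤ Real.exp m * Real.exp (b * f x + c - m) := by
              gcongr; exact Real.add_one_le_exp _
          _ = _ := by rw [← Real.exp_add]; ring_nf

/-- Jensen's inequality one coordinate at a time: given `ω` the tangent draws are independent, and
the terms of the other coordinates enter as the constant `c`. -/
lemma ofReal_exp_sum_integral_le_tangentKernel {f : A → ℝ} (hf : Measurable f) {M : ℝ}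
    (hM : ∀ x, |f x| ≤ M) (ω : Ω) (n k : ℕ) (b : Fin n → ℝ) (c : ℝ) :
    ENNReal.ofReal (Real.exp (∑ i, b i * ∫ x, f x ∂P (k + i) (history Z (k + i) ω) + c)) ≤
      ∫⁻ x, ENNReal.ofReal (Real.exp (∑ i, b i * f (x i) + c)) ∂tangentKernel P Z hZ n k ω := by
  induction n generalizing k c with
  | zero => rw [lintegral_tangentKernel_zero]; simp
  | succ n ih =>
    rw [lintegral_tangentKernel_succ _ _ _ _ _ _ (by fun_prop)]
    have hint : ∀ (j : ℕ), Integrable f (P j (history Z j ω)) := fun j =>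
      Integrable.of_bound hf.aestronglyMeasurable M (Filter.Eventually.of_forall hM)
    have hidx : ∀ j : ℕ, ∫ x, f x ∂P (k + (j + 1)) (history Z (k + (j + 1)) ω) =
        ∫ x, f x ∂P (k + 1 + j) (history Z (k + 1 + j) ω) := fun j => by
      rw [show k + (j + 1) = k + 1 + j by omega]
    simp only [Fin.sum_univ_succ, Fin.cons_zero, Fin.cons_succ, Fin.val_zero, Fin.val_succ,
      hidx]
    refine le_trans (b := ∫⁻ a, ENNReal.ofReal (Real.exp (b 0 * f a + (∑ i : Fin n, b i.succ *
        ∫ x, f x ∂P (k + 1 + i) (history Z (k + 1 + i) ω) + c))) ∂P k (history Z k ω))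
      ?_ (lintegral_mono fun a => (le_trans (le_of_eq ?_) (ih (k + 1)
      (fun i => b i.succ) (b 0 * f a + c))).trans (le_of_eq ?_))
    · rw [add_assoc]
      exact ofReal_exp_integral_le _ (hint k) _ _
    · congr 2; ring
    · refine lintegral_congr fun x => ?_
      congr 2; ring

end Tangent

/-! ### Rademacher sums on real-valued trees. -/

/-- The sign `±1` encoded by a Boolean. -/
def boolSign (b : Bool) : ℝ := if b then 1 else -1

lemma abs_boolSign (b : Bool) : |boolSign b| = 1 := by cases b <;> simp [boolSign]

lemma sum_signs_succ {n : ℕ} (F : (Fin (n + 1) → Bool) → ℝ) :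
    ∑ σ, F σ =
      ∑ τ : Fin n → Bool, F (Fin.cons true τ) + ∑ τ : Fin n → Bool, F (Fin.cons false τ) := by
  rw [← (Fin.consEquiv fun _ : Fin (n + 1) => Bool).sum_comp, Fintype.sum_prod_type]
  simp [Fin.consEquiv]

/-- The Hoeffding bound for a Rademacher sum along the paths of a tree. -/
lemma sum_exp_label_le {n : ℕ} (c : ℝ → ℝ) {B : ℝ} (hc : ∀ x, |c x| ≤ B) (b : Fin n → ℝ)
    (v : BinTree ℝ n) :
    ∑ σ, Real.exp (∑ t, b t * boolSign (σ t) * c (v.label σ t)) ≤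
      2 ^ n * Real.exp (∑ t, b t ^ 2 * B ^ 2 / 2) := by
  induction n with
  | zero => simp
  | succ n ih =>
    obtain ⟨x, l, r⟩ := v
    have hl := ih (fun t => b t.succ) l
    have hr := ih (fun t => b t.succ) r
    have e1 : ∀ (s : Bool) (τ : Fin n → Bool),
        Real.exp (∑ t, b t * boolSign ((Fin.cons s τ : Fin (n + 1) → Bool) t) *
          c (BinTree.label (n := n + 1) (x, l, r) (Fin.cons s τ) t)) =
        Real.exp (b 0 * boolSign s * c x) *
          Real.exp (∑ t, b t.succ * boolSign (τ t) *
            c (BinTree.label (if s then l else r) τ t)) := by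
      intro s τ
      rw [← Real.exp_add, Fin.sum_univ_succ, BinTree.label_succ]
      cases s <;> simp
    rw [sum_signs_succ]
    simp_rw [e1, ← Finset.mul_sum]
    simp only [if_true, Bool.false_eq_true, if_false, boolSign, mul_one, mul_neg, neg_mul]
    rw [Fin.sum_univ_succ, Real.exp_add]
    set S := Real.exp (∑ t : Fin n, b t.succ ^ 2 * B ^ 2 / 2)
    -- The root value does not depend on the sign at the root, so averaging over that sign gives a
    -- `cosh`.
    have hcosh : Real.exp (b 0 * c x) + Real.exp (-(b 0 * c x)) ≤
        2 * Real.exp (b 0 ^ 2 * B ^ 2 / 2) := by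
      have h1 := Real.cosh_le_exp_half_sq (b 0 * c x)
      rw [Real.cosh_eq] at h1
      have h2 : Real.exp ((b 0 * c x) ^ 2 / 2) ≤ Real.exp (b 0 ^ 2 * B ^ 2 / 2) := by
        have : c x ^ 2 ≤ B ^ 2 := sq_le_sq' (abs_le.1 (hc x)).1 (abs_le.1 (hc x)).2
        rw [mul_pow]; gcongr
      linarith
    calc _ ≤ Real.exp (b 0 * c x) * (2 ^ n * S) + Real.exp (-(b 0 * c x)) * (2 ^ n * S) := by
          simp only [boolSign] at hl hr
          gcongr
      _ = (Real.exp (b 0 * c x) + Real.exp (-(b 0 * c x))) * (2 ^ n * S) := by ring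
      _ ≤ (2 * Real.exp (b 0 ^ 2 * B ^ 2 / 2)) * (2 ^ n * S) := by gcongr
      _ = _ := by rw [pow_succ]; ring

/-! ### Covers and the exponential supremum on a fixed tree. -/

lemma one_le_seqCoveringNumber {A : Type*} {T : ℕ} (w : Fin T → ℝ) (α : ℝ) {G : Set (A → ℝ)}
    (hG : G.Nonempty) (z : BinTree A T) : 1 ≤ seqCoveringNumber w α G z := by
  obtain ⟨g, hg⟩ := hG
  refine le_iInf₂ fun V hV => ?_
  obtain ⟨v, hv, -⟩ := hV g hg fun _ => true
  exact Set.one_le_encard_iff_nonempty.2 ⟨v, hv⟩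

lemma exists_isSeqCover_finite {A : Type*} {T : ℕ} {w : Fin T → ℝ} {α : ℝ} {G : Set (A → ℝ)}
    {z : BinTree A T} (h : seqCoveringNumber w α G z ≠ ⊤) :
    ∃ V : Finset (BinTree ℝ T), IsSeqCover w α G z V ∧
      (V.card : ℕ∞) ≤ seqCoveringNumber w α G z := by
  -- In `ℕ∞`, a cover of size below `N + 1` with `N` finite has size at most `N`, so the infimum is
  -- attained.
  have h1 : seqCoveringNumber w α G z < seqCoveringNumber w α G z + 1 :=
    (ENat.lt_add_one_iff h).2 le_rfl
  conv_lhs at h1 => unfold seqCoveringNumber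
  simp only [iInf_lt_iff] at h1
  obtain ⟨V, hV, h2⟩ := h1
  have h3 := (ENat.lt_add_one_iff h).1 h2
  have hfin : V.Finite := Set.encard_ne_top_iff.1 (ne_top_of_le_ne_top h h3)
  lift V to Finset (BinTree ℝ T) using hfin
  exact ⟨V, hV, by simpa using h3⟩

/-- Clipping to `[0, M]` is 1-Lipschitz and fixes `x`. Cover elements, which are arbitrary real
trees, may thus be clipped without loss. -/
lemma abs_clip_sub_le {M x y : ℝ} (hx : 0 ≤ x) (hx' : x ≤ M) :
    |max 0 (min y M) - x| ≤ |y - x| := by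
  have h1 : max 0 (min x M) = x := by rw [min_eq_left hx', max_eq_right hx]
  conv_lhs => rw [← h1]
  refine (abs_max_sub_max_le_max _ _ _ _).trans ?_
  refine max_le (by simp) ((abs_min_sub_min_le_max _ _ _ _).trans (by simp))

/-- The weighted sum of the values of `g` at the points `x`, recentred at `M / 2`. -/
noncomputable def centredSum {A : Type*} {T : ℕ} (M : ℝ) (a : Fin T → ℝ) (g : A → ℝ)
    (x : Fin T → A) : ℝ := ∑ t, a t * (g (x t) - M / 2)

/-- The exponential supremum of the recentred weighted sums over the class `G`. -/
noncomputable def expSup {A : Type*} {T : ℕ} (G : Set (A → ℝ)) (M l : ℝ) (a : Fin T → ℝ)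
    (x : Fin T → A) : ℝ≥0∞ :=
  ENNReal.ofReal (Real.exp (l * ((⨆ g : G, ∑ t, a t * g.1 (x t)) - ∑ t, a t * (M / 2))))

section Bounds

variable {A : Type*} {T : ℕ} {G : Set (A → ℝ)} {M : ℝ}

lemma bddAbove_weightedSum (hM : ∀ g ∈ G, ∀ x, |g x| ≤ M) (a : Fin T → ℝ) (x : Fin T → A) :
    BddAbove (Set.range fun g : G => ∑ t, a t * g.1 (x t)) := by
  refine ⟨∑ t, |a t| * M, ?_⟩
  rintro _ ⟨g, rfl⟩
  refine Finset.sum_le_sum fun t _ => (le_abs_self _).trans ?_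
  rw [abs_mul]
  exact mul_le_mul_of_nonneg_left (hM g g.2 _) (abs_nonneg _)

lemma centredSum_eq (a : Fin T → ℝ) (g : A → ℝ) (x : Fin T → A) :
    centredSum M a g x = ∑ t, a t * g (x t) - ∑ t, a t * (M / 2) := by
  simp [centredSum, mul_sub, Finset.sum_sub_distrib]

lemma ofReal_exp_centredSum_le_expSup (hM : ∀ g ∈ G, ∀ x, |g x| ≤ M) {l : ℝ} (hl : 0 ≤ l)
    (a : Fin T → ℝ) {g : A → ℝ} (hg : g ∈ G) (x : Fin T → A) :
    ENNReal.ofReal (Real.exp (l * centredSum M a g x)) ≤ expSup G M l a x := by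
  unfold expSup
  rw [centredSum_eq]
  gcongr
  exact le_ciSup (bddAbove_weightedSum hM a x) ⟨g, hg⟩

lemma expSup_le (hne : G.Nonempty) {l : ℝ} (hl : 0 < l) (a : Fin T → ℝ) (x : Fin T → A) {R : ℝ}
    (h : ∀ g ∈ G, Real.exp (l * centredSum M a g x) ≤ R) :
    expSup G M l a x ≤ ENNReal.ofReal R := by
  obtain ⟨g₀, hg₀⟩ := hne
  have hR : 0 < R := (Real.exp_pos _).trans_le (h g₀ hg₀)
  have : Nonempty G := ⟨⟨g₀, hg₀⟩⟩
  refine ENNReal.ofReal_le_ofReal ?_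
  rw [← Real.le_log_iff_exp_le hR, ← le_div_iff₀' hl, sub_le_iff_le_add]
  refine ciSup_le fun g => ?_
  rw [← sub_le_iff_le_add, ← centredSum_eq, le_div_iff₀' hl, Real.le_log_iff_exp_le hR]
  exact h g g.2

/-- Replacing `g` by the clipped cover element costs at most `‖w‖` times the `ℓ₁` distance along the
path, which is at most `α`; the centring cancels in the difference. -/
lemma centredSum_le_of_cover (h0 : ∀ g ∈ G, ∀ x, 0 ≤ g x) (hM : ∀ g ∈ G, ∀ x, |g x| ≤ M)
    {w a : Fin T → ℝ} (ha : ∀ t, |a t| = |w t|) {α : ℝ} {z : BinTree A T} {σ : Fin T → Bool}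
    {g : A → ℝ} (hg : g ∈ G) {v : BinTree ℝ T}
    (hv : ‖w‖ * ∑ t, |v.label σ t - g (z.label σ t)| ≤ α) :
    centredSum M a g (z.label σ) ≤
      α + ∑ t, a t * (max 0 (min (v.label σ t) M) - M / 2) := by
  have key : centredSum M a g (z.label σ) -
      ∑ t, a t * (max 0 (min (v.label σ t) M) - M / 2) ≤
      ‖w‖ * ∑ t, |v.label σ t - g (z.label σ t)| := by
    rw [centredSum, ← Finset.sum_sub_distrib, Finset.mul_sum]
    refine Finset.sum_le_sum fun t _ => ?_
    rw [← mul_sub]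
    refine (le_abs_self _).trans ?_
    rw [abs_mul, ha]
    rw [sub_sub_sub_cancel_right, abs_sub_comm]
    exact mul_le_mul (norm_le_pi_norm w t)
      (abs_clip_sub_le (h0 g hg _) ((le_abs_self _).trans (hM g hg _))) (abs_nonneg _)
      (norm_nonneg _)
  linarith

/-- The average over the signs of the exponential supremum on a tree is controlled by its
covering number. -/
lemma sum_expSup_label_le (hne : G.Nonempty) (h0 : ∀ g ∈ G, ∀ x, 0 ≤ g x)
    (hM : ∀ g ∈ G, ∀ x, |g x| ≤ M) (hM0 : 0 ≤ M) (w : Fin T → ℝ) (α : ℝ) {l : ℝ} (hl : 0 < l)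
    (z : BinTree A T) :
    ∑ σ, expSup G M (2 * l) (fun t => -w t * boolSign (σ t)) (z.label σ) ≤
      2 ^ T * (ENNReal.ofReal (Real.exp (2 * l * α + l ^ 2 * M ^ 2 * (∑ t, w t ^ 2) / 2)) *
        (seqCoveringNumber w α G z : ℝ≥0∞)) := by
  set C := Real.exp (2 * l * α + l ^ 2 * M ^ 2 * (∑ t, w t ^ 2) / 2) with hC
  by_cases htop : seqCoveringNumber w α G z = ⊤
  · rw [htop, ENat.toENNReal_top, ENNReal.mul_top (by simp [hC, Real.exp_pos]),
      ENNReal.mul_top (by simp)]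
    exact le_top
  obtain ⟨V, hV, hcard⟩ := exists_isSeqCover_finite htop
  set c : ℝ → ℝ := fun x => max 0 (min x M) - M / 2 with hcdef
  have hc : ∀ x, |c x| ≤ M / 2 := by
    intro x
    rw [abs_le]
    have h1 : 0 ≤ max 0 (min x M) := le_max_left _ _
    have h2 : max 0 (min x M) ≤ M := max_le hM0 (min_le_right _ _)
    constructor <;> simp only [hcdef] <;> linarith
  have hσ : ∀ σ : Fin T → Bool,
      expSup G M (2 * l) (fun t => -w t * boolSign (σ t)) (z.label σ) ≤
      ENNReal.ofReal (∑ v ∈ V, Real.exp (2 * l * α) *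
        Real.exp (∑ t, (-(2 * l * w t)) * boolSign (σ t) * c (v.label σ t))) := by
    intro σ
    refine expSup_le hne (by positivity) _ _ fun g hg => ?_
    obtain ⟨v, hvV, hv⟩ := hV g hg σ
    -- The element `v` depends on `g` and `σ`; the sum over all of `V` depends on neither choice.
    refine le_trans ?_ (Finset.single_le_sum (fun v _ => by positivity) hvV)
    rw [← Real.exp_add, Real.exp_le_exp]
    have h1 := centredSum_le_of_cover h0 hM (a := fun t => -w t * boolSign (σ t))
      (fun t => by rw [abs_mul, abs_boolSign, mul_one, abs_neg]) hg hv
    have h2 := mul_le_mul_of_nonneg_left h1 (by positivity : 0 ≤ 2 * l)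
    refine h2.trans (le_of_eq ?_)
    rw [mul_add, Finset.mul_sum]
    congr 1
    refine Finset.sum_congr rfl fun t _ => ?_
    simp only [hcdef]; ring
  calc _ ≤ ∑ σ : Fin T → Bool, ENNReal.ofReal (∑ v ∈ V, Real.exp (2 * l * α) *
        Real.exp (∑ t, (-(2 * l * w t)) * boolSign (σ t) * c (v.label σ t))) :=
        Finset.sum_le_sum fun σ _ => hσ σ
    _ = ENNReal.ofReal (∑ v ∈ V, Real.exp (2 * l * α) * ∑ σ : Fin T → Bool,
        Real.exp (∑ t, (-(2 * l * w t)) * boolSign (σ t) * c (v.label σ t))) := by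
        rw [← ENNReal.ofReal_sum_of_nonneg (fun _ _ => by positivity), Finset.sum_comm]
        simp_rw [Finset.mul_sum]
    _ ≤ ENNReal.ofReal (∑ v ∈ V, 2 ^ T * C) := by
        refine ENNReal.ofReal_le_ofReal (Finset.sum_le_sum fun v _ => ?_)
        refine (mul_le_mul_of_nonneg_left (sum_exp_label_le c hc _ v)
          (by positivity)).trans (le_of_eq ?_)
        -- Coefficients `2 l w_t` and range `M / 2` give `(2 l w_t)² (M / 2)² / 2 = l² M² w_t² / 2`.
        rw [mul_left_comm, ← Real.exp_add, hC, Finset.mul_sum, Finset.sum_div]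
        congr 3
        refine Finset.sum_congr rfl fun t _ => ?_
        ring
    _ = 2 ^ T * (ENNReal.ofReal C * (V.card : ℝ≥0∞)) := by
        rw [Finset.sum_const, nsmul_eq_mul, ENNReal.ofReal_mul (by positivity),
          ENNReal.ofReal_mul (by positivity)]
        simp
        ring
    _ ≤ _ := by
        gcongr
        have := ENat.toENNReal_mono hcard
        simpa using this

end Bounds

/-! ### Measurable majorants and symmetrization. -/

/-- The majorant is `⊤` on a measurable null set containing the points where `f` differs from its
measurable version. Domination at every point is what the pathwise argument requires. -/
lemma AEMeasurable.exists_measurable_ge {B : Type*} [MeasurableSpace B] {ν : Measure B}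
    {f : B → ℝ≥0∞} (hf : AEMeasurable f ν) :
    ∃ g : B → ℝ≥0∞, Measurable g ∧ f ≤ g ∧ g =ᵐ[ν] f := by
  classical
  set s := toMeasurable ν {x | f x ≠ hf.mk f x} with hs
  have hs0 : ν s = 0 := by
    rw [hs, measure_toMeasurable]
    exact hf.ae_eq_mk
  have hmem : ∀ x, x ∉ s → f x = hf.mk f x := fun x hx => by
    by_contra h
    exact hx (subset_toMeasurable _ _ h)
  refine ⟨s.piecewise (fun _ => ⊤) (hf.mk f),
    measurable_const.piecewise (measurableSet_toMeasurable _ _) hf.measurable_mk,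
    fun x => ?_, ?_⟩
  · by_cases hx : x ∈ s
    · simp [hx]
    · simp [hx, hmem x hx]
  · have : ∀ᵐ x ∂ν, x ∉ s := measure_eq_zero_iff_ae_notMem.1 hs0
    filter_upwards [this] with x hx
    simp [hx, hmem x hx]

section Symmetrization

variable {A : Type*} {T : ℕ} {G : Set (A → ℝ)} {M : ℝ}

/-- At each `t` one of the paths `σ`, `-σ` contributes `-w_t` at `y t` and the other `w_t` at `y'
t`, so the recentring by `M / 2` cancels. -/
lemma centredSum_signSelect_add_not (w : Fin T → ℝ) (g : A → ℝ) (y y' : Fin T → A)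
    (σ : Fin T → Bool) :
    centredSum M (fun t => -w t * boolSign (σ t)) g (signSelect σ y y') +
      centredSum M (fun t => -w t * boolSign (!σ t)) g (signSelect (fun t => !σ t) y y') =
      ∑ t, w t * (g (y' t) - g (y t)) := by
  rw [centredSum, centredSum, ← Finset.sum_add_distrib]
  refine Finset.sum_congr rfl fun t _ => ?_
  cases h : σ t <;> simp [signSelect, boolSign, h] <;> ring

/-- Pointwise symmetrization: a weighted difference between the sequence `y` and its decoupled
copy `y'` is controlled by signed sums along all selections of the two sequences. -/
lemma ofReal_exp_sub_le_sum_expSup (hM : ∀ g ∈ G, ∀ x, |g x| ≤ M) {l : ℝ} (hl : 0 ≤ l)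
    (w : Fin T → ℝ) {g : A → ℝ} (hg : g ∈ G) (y y' : Fin T → A) :
    2 ^ T * ENNReal.ofReal (Real.exp (l * ∑ t, w t * (g (y' t) - g (y t)))) ≤
      ∑ σ, expSup G M (2 * l) (fun t => -w t * boolSign (σ t)) (signSelect σ y y') := by
  set X : (Fin T → Bool) → ℝ := fun σ =>
    centredSum M (fun t => -w t * boolSign (σ t)) g (signSelect σ y y') with hX
  set S := ∑ t, w t * (g (y' t) - g (y t))
  have h1 : ∀ σ : Fin T → Bool, Real.exp (l * S) ≤
      (Real.exp (2 * l * X σ) + Real.exp (2 * l * X fun t => !σ t)) / 2 := by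
    intro σ
    rw [show l * S = l * X σ + l * X (fun t => !σ t) by
      rw [← mul_add]; exact congrArg _ (centredSum_signSelect_add_not w g y y' σ).symm,
      Real.exp_add, show 2 * l * X σ = l * X σ + l * X σ by ring,
      show 2 * l * X (fun t => !σ t) = l * X (fun t => !σ t) + l * X (fun t => !σ t) by ring,
      Real.exp_add, Real.exp_add]
    nlinarith [sq_nonneg (Real.exp (l * X σ) - Real.exp (l * X fun t => !σ t))]
  -- Flipping all signs permutes the paths.
  have hneg : ∑ σ : Fin T → Bool, Real.exp (2 * l * X fun t => !σ t) =
      ∑ σ, Real.exp (2 * l * X σ) :=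
    (Equiv.piCongrRight fun _ : Fin T => Equiv.boolNot).sum_comp
      fun σ => Real.exp (2 * l * X σ)
  have h2 : 2 ^ T * Real.exp (l * S) ≤ ∑ σ, Real.exp (2 * l * X σ) := by
    have h3 := Finset.sum_le_sum fun σ (_ : σ ∈ Finset.univ) => h1 σ
    rw [← Finset.sum_div, Finset.sum_add_distrib, hneg] at h3
    simp at h3
    linarith
  calc 2 ^ T * ENNReal.ofReal (Real.exp (l * S))
      = ENNReal.ofReal (2 ^ T * Real.exp (l * S)) := by
        rw [ENNReal.ofReal_mul (by positivity)]; simp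
    _ ≤ ENNReal.ofReal (∑ σ, Real.exp (2 * l * X σ)) := ENNReal.ofReal_le_ofReal h2
    _ = ∑ σ, ENNReal.ofReal (Real.exp (2 * l * X σ)) :=
        ENNReal.ofReal_sum_of_nonneg fun _ _ => by positivity
    _ ≤ _ := Finset.sum_le_sum fun σ _ =>
        ofReal_exp_centredSum_le_expSup hM (by positivity) _ hg _

end Symmetrization

/-! ### The Chernoff bound and the choice of its parameter. -/

section Deviation

variable {Ω A : Type*} [MeasurableSpace Ω] [MeasurableSpace A]
  {P : (k : ℕ) → Kernel (Fin k → A) A} [∀ k, IsMarkovKernel (P k)]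
  {Z : ℕ → Ω → A} {F : Set (A → ℝ)} {M : ℝ}

lemma aemeasurable_expSup {T : ℕ} (hF : IsMeasurableClass F) (l : ℝ) (a : Fin T → ℝ)
    (ν : Measure (Fin T → A)) [IsProbabilityMeasure ν] : AEMeasurable (expSup F M l a) ν := by
  have h := hF.aemeasurable_iSup T a ν inferInstance
  exact (Real.measurable_exp.comp_aemeasurable
    ((h.sub_const _).const_mul l)).ennreal_ofReal

/-- The right side is the same for all `f`, so one application of Markov's inequality to it controls
the whole class, with no measurability of the supremum of deviations. -/
lemma exp_moment_tangent_le (hZ : ∀ i, Measurable (Z i)) (hF : IsMeasurableClass F)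
    (hM : ∀ g ∈ F, ∀ x, |g x| ≤ M) {l : ℝ} (hl : 0 ≤ l) {T : ℕ} (w : Fin T → ℝ)
    {θ : (Fin T → Bool) → (Fin T → A) → ℝ≥0∞}
    (hθ : ∀ σ, expSup F M (2 * l) (fun t => -w t * boolSign (σ t)) ≤ θ σ) {f : A → ℝ}
    (hf : f ∈ F) (ω : Ω) :
    2 ^ T * ENNReal.ofReal (Real.exp (l * ∑ t : Fin T,
        w t * (∫ x, f x ∂P t (history Z t ω) - f (Z t ω)))) ≤
      ∫⁻ x, ∑ σ, θ σ (signSelect σ (fun i => Z i ω) x) ∂tangentKernel P Z hZ T 0 ω := by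
  have h1 := ofReal_exp_sum_integral_le_tangentKernel P Z hZ (hF.measurable f hf) (hM f hf) ω T 0
    (fun t => l * w t) (-∑ t : Fin T, l * w t * f (Z t ω))
  have hidx : ∀ j : ℕ, ∫ x, f x ∂P (0 + j) (history Z (0 + j) ω) =
        ∫ x, f x ∂P j (history Z j ω) := fun j => by rw [zero_add]
  simp only [hidx] at h1
  have e1 : ∀ u : Fin T → ℝ, ∑ t, l * w t * u t + -∑ t : Fin T, l * w t * f (Z t ω) =
      l * ∑ t, w t * (u t - f (Z t ω)) := by
    intro u
    rw [← sub_eq_add_neg, ← Finset.sum_sub_distrib, Finset.mul_sum]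
    exact Finset.sum_congr rfl fun t _ => by ring
  simp only [e1] at h1
  calc _ ≤ 2 ^ T * ∫⁻ x, ENNReal.ofReal (Real.exp (l * ∑ t : Fin T,
        w t * (f (x t) - f (Z t ω)))) ∂tangentKernel P Z hZ T 0 ω := by gcongr
    _ = ∫⁻ x, 2 ^ T * ENNReal.ofReal (Real.exp (l * ∑ t : Fin T,
        w t * (f (x t) - f (Z t ω)))) ∂tangentKernel P Z hZ T 0 ω :=
        (lintegral_const_mul' _ _ (by simp)).symm
    _ ≤ _ := lintegral_mono fun x =>
        (ofReal_exp_sub_le_sum_expSup hM hl w hf (fun i => Z i ω) x).trans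
          (Finset.sum_le_sum fun σ _ => hθ σ _)

/-- Chernoff bound for the uniform deviation of the conditional expectations. -/
lemma measure_exists_deviation_le {μ : Measure Ω} [IsProbabilityMeasure μ]
    (hZ : ∀ i, Measurable (Z i)) {T : ℕ}
    (hP : ∀ k < T, HasCondDistrib (Z k) (history Z k) (P k) μ)
    (hF : IsMeasurableClass F) (hne : F.Nonempty) (h0 : ∀ g ∈ F, ∀ x, 0 ≤ g x)
    (hM : ∀ g ∈ F, ∀ x, |g x| ≤ M) (hM0 : 0 ≤ M) (w : Fin T → ℝ) (α ε : ℝ) {l : ℝ}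
    (hl : 0 < l) :
    ENNReal.ofReal (Real.exp (l * ε)) * μ {ω | ∃ f ∈ F, ε < ∑ t : Fin T,
        w t * (∫ x, f x ∂P t (history Z t ω) - f (Z t ω))} ≤
      ENNReal.ofReal (Real.exp (2 * l * α + l ^ 2 * M ^ 2 * (∑ t, w t ^ 2) / 2)) *
        expectedSeqCoveringNumber P w α F := by
  have : IsProbabilityMeasure (treeLaw P T) :=
    inferInstanceAs (IsProbabilityMeasure (treeKernel P T 0 Fin.elim0))
  set C := ENNReal.ofReal (Real.exp (2 * l * α + l ^ 2 * M ^ 2 * (∑ t, w t ^ 2) / 2))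
  have hlab : ∀ σ : Fin T → Bool, AEMeasurable (fun z : BinTree A T => z.label σ) (treeLaw P T) :=
    fun σ => (BinTree.measurable_label σ).aemeasurable
  have hsup : ∀ σ : Fin T → Bool,
      AEMeasurable (expSup F M (2 * l) fun t => -w t * boolSign (σ t))
        ((treeLaw P T).map fun z => z.label σ) := fun σ =>
    have := Measure.isProbabilityMeasure_map (hlab σ)
    aemeasurable_expSup hF _ _ _
  -- The exponential suprema are only a.e. measurable. The majorants dominate everywhere and agree
  -- with them a.e. for the law of the labels along `σ`, so nothing is lost after passing to the
  -- tree.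
  choose θ hθm hθge hθae using fun σ => (hsup σ).exists_measurable_ge
  set Θ : Ω → ℝ≥0∞ := fun ω =>
    ∫⁻ x, ∑ σ, θ σ (signSelect σ (fun i => Z i ω) x) ∂tangentKernel P Z hZ T 0 ω with hΘ
  have hsel : ∀ σ, Measurable fun q : Ω × (Fin T → A) =>
      θ σ (signSelect σ (fun i => Z i q.1) q.2) := fun σ =>
    (hθm σ).comp (Measurable.comp (f := fun q : Ω × (Fin T → A) => (fun i : Fin T => Z i q.1, q.2))
      (measurable_signSelect σ) (Measurable.prodMk
        (measurable_pi_lambda _ fun i : Fin T => (hZ i).comp measurable_fst) measurable_snd))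
  have hΘm : Measurable Θ :=
    Measurable.lintegral_kernel_prod_right' (κ := tangentKernel P Z hZ T 0)
      (f := fun q : Ω × (Fin T → A) => ∑ σ, θ σ (signSelect σ (fun i => Z i q.1) q.2))
      (Finset.measurable_sum _ fun σ _ => hsel σ)
  have hint : ∫⁻ ω, Θ ω ∂μ ≤ 2 ^ T * (C * expectedSeqCoveringNumber P w α F) := by
    calc ∫⁻ ω, Θ ω ∂μ
        = ∫⁻ ω, ∑ σ, ∫⁻ x, θ σ (signSelect σ (fun i => Z i ω) x)
            ∂tangentKernel P Z hZ T 0 ω ∂μ := by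
          refine lintegral_congr fun ω => ?_
          exact lintegral_finsetSum _ fun σ _ => (hsel σ).comp measurable_prodMk_left
      _ = ∑ σ, ∫⁻ ω, ∫⁻ x, θ σ (signSelect σ (fun i => Z i ω) x)
            ∂tangentKernel P Z hZ T 0 ω ∂μ :=
          lintegral_finsetSum _ fun σ _ => Measurable.lintegral_kernel_prod_right'
            (κ := tangentKernel P Z hZ T 0)
            (f := fun q : Ω × (Fin T → A) => θ σ (signSelect σ (fun i => Z i q.1) q.2)) (hsel σ)
      _ = ∑ σ, ∫⁻ z, θ σ (BinTree.label z σ) ∂treeLaw P T := by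
          refine Finset.sum_congr rfl fun σ _ => ?_
          have h1 := lintegral_signSelect_tangentKernel P Z hZ hP T 0 (by omega) σ
            (g := fun _ x => θ σ x) ((hθm σ).comp measurable_snd)
          simp only [zero_add] at h1
          rw [h1]
          have h2 : ∀ ω, history Z 0 ω = Fin.elim0 := fun ω => Subsingleton.elim _ _
          simp_rw [h2]
          rw [lintegral_const, measure_univ, mul_one]
          rfl
      _ = ∑ σ, ∫⁻ z, expSup F M (2 * l) (fun t => -w t * boolSign (σ t)) (BinTree.label z σ)
            ∂treeLaw P T :=
          Finset.sum_congr rfl fun σ _ => lintegral_congr_ae (ae_of_ae_map (hlab σ) (hθae σ))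
      _ = ∫⁻ z, ∑ σ, expSup F M (2 * l) (fun t => -w t * boolSign (σ t)) (BinTree.label z σ)
            ∂treeLaw P T :=
          (lintegral_finsetSum' _ fun σ _ => (hsup σ).comp_aemeasurable (hlab σ)).symm
      _ ≤ ∫⁻ z, 2 ^ T * (C * (seqCoveringNumber w α F z : ℝ≥0∞)) ∂treeLaw P T :=
          lintegral_mono fun z => sum_expSup_label_le hne h0 hM hM0 w α hl z
      _ = _ := by
          rw [lintegral_const_mul' _ _ (by simp), lintegral_const_mul' _ _ ENNReal.ofReal_ne_top]
          rfl
  have hsub : {ω | ∃ f ∈ F, ε < ∑ t : Fin T,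
        w t * (∫ x, f x ∂P t (history Z t ω) - f (Z t ω))} ⊆
      {ω | 2 ^ T * ENNReal.ofReal (Real.exp (l * ε)) ≤ Θ ω} := by
    rintro ω ⟨f, hf, hε⟩
    refine le_trans ?_ (exp_moment_tangent_le hZ hF hM hl.le w hθge hf ω)
    gcongr
  have hmarkov := mul_meas_ge_le_lintegral (μ := μ) hΘm (2 ^ T * ENNReal.ofReal (Real.exp (l * ε)))
  have h3 : 2 ^ T * (ENNReal.ofReal (Real.exp (l * ε)) * μ {ω | ∃ f ∈ F, ε < ∑ t : Fin T,
        w t * (∫ x, f x ∂P t (history Z t ω) - f (Z t ω))}) ≤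
      2 ^ T * (C * expectedSeqCoveringNumber P w α F) := by
    rw [← mul_assoc]
    exact (mul_le_mul_right (measure_mono hsub) _).trans (hmarkov.trans hint)
  exact (ENNReal.mul_le_mul_iff_right (by simp) (by simp)).1 h3

lemma one_le_expectedSeqCoveringNumber (hne : F.Nonempty) {T : ℕ} (w : Fin T → ℝ) (α : ℝ) :
    1 ≤ expectedSeqCoveringNumber P w α F := by
  have : IsProbabilityMeasure (treeLaw P T) :=
    inferInstanceAs (IsProbabilityMeasure (treeKernel P T 0 Fin.elim0))
  calc (1 : ℝ≥0∞) = ∫⁻ _, 1 ∂treeLaw P T := by simp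
    _ ≤ _ := lintegral_mono fun z => by
        have := ENat.toENNReal_mono (one_le_seqCoveringNumber w α hne z)
        simpa using this

/-- With probability at least `1 - δ` no function of the class deviates by more than the
covering bound at scale `α`. -/
lemma measure_exists_deviation_le_ofReal {μ : Measure Ω} [IsProbabilityMeasure μ]
    (hZ : ∀ i, Measurable (Z i)) {T : ℕ}
    (hP : ∀ k < T, HasCondDistrib (Z k) (history Z k) (P k) μ)
    (hF : IsMeasurableClass F) (hne : F.Nonempty) (h0 : ∀ g ∈ F, ∀ x, 0 ≤ g x)
    (hM : ∀ g ∈ F, ∀ x, |g x| ≤ M) (hM0 : 0 ≤ M) (w : Fin T → ℝ) {α δ : ℝ} (hα : 0 < α)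
    (hδ : 0 < δ) (hδ1 : δ < 1) (hfin : expectedSeqCoveringNumber P w α F ≠ ⊤) :
    μ {ω | ∃ f ∈ F, 2 * α + M * √(∑ t, w t ^ 2) *
        √(2 * Real.log ((expectedSeqCoveringNumber P w α F).toReal / δ)) <
        ∑ t : Fin T, w t * (∫ x, f x ∂P t (history Z t ω) - f (Z t ω))} ≤ ENNReal.ofReal δ := by
  set N := expectedSeqCoveringNumber P w α F with hN
  have hN1 : 1 ≤ N.toReal := by
    have := ENNReal.toReal_mono hfin (one_le_expectedSeqCoveringNumber (P := P) hne w α)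
    simpa using this
  set L := Real.log (N.toReal / δ) with hL
  have hNδ : 1 < N.toReal / δ := by rw [one_lt_div hδ]; linarith
  have hLpos : 0 < L := Real.log_pos hNδ
  set W := ∑ t, w t ^ 2 with hW
  have hW0 : 0 ≤ W := Finset.sum_nonneg fun t _ => sq_nonneg _
  -- If `M = 0` or `w = 0` every deviation vanishes, while the threshold is `2 * α > 0`; this also
  -- keeps the denominator of `l` nonzero.
  rcases (mul_nonneg hM0 (Real.sqrt_nonneg W)).eq_or_lt' with hzero | hpos
  · refine le_of_eq_of_le ?_ zero_le
    convert measure_empty (μ := μ)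
    rw [Set.eq_empty_iff_forall_notMem]
    rintro ω ⟨f, hf, hlt⟩
    rw [hzero, zero_mul, add_zero] at hlt
    have : ∑ t : Fin T, w t * (∫ x, f x ∂P t (history Z t ω) - f (Z t ω)) = 0 := by
      refine Finset.sum_eq_zero fun t _ => ?_
      rcases mul_eq_zero.1 hzero with hM' | hW'
      · have hf0 : f = 0 := funext fun x =>
          abs_eq_zero.1 (le_antisymm ((hM f hf x).trans hM'.le) (abs_nonneg _))
        simp [hf0]
      · have hW1 : W = 0 := (Real.sqrt_eq_zero hW0).1 hW'
        have := (Finset.sum_eq_zero_iff_of_nonneg fun t _ => sq_nonneg (w t)).1 hW1 t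
          (Finset.mem_univ t)
        simp [pow_eq_zero_iff two_ne_zero |>.1 this]
    linarith
  · set ε := 2 * α + M * √W * √(2 * L) with hε
    -- This `l` minimizes `l² M² W / 2 - l M √W √(2 L)`. The minimum is `-L`, and `exp (-L)` times
    -- the expected covering number is `δ`.
    set l := √(2 * L) / (M * √W) with hl
    have hlpos : 0 < l := div_pos (Real.sqrt_pos.2 (by positivity)) hpos
    have key := measure_exists_deviation_le (μ := μ) hZ hP hF hne h0 hM hM0 w α ε hlpos
    have h1 : l * (M * √W) = √(2 * L) := div_mul_cancel₀ _ hpos.ne'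
    have h2 : √(2 * L) ^ 2 = 2 * L := Real.sq_sqrt (by positivity)
    have h3 : √W ^ 2 = W := Real.sq_sqrt hW0
    have h4 : l ^ 2 * M ^ 2 * W = 2 * L := by
      rw [← h2, ← h1, mul_pow, mul_pow, h3]; ring
    have h5 : 2 * l * α + l ^ 2 * M ^ 2 * W / 2 = l * ε + -L := by
      have : l * ε = 2 * l * α + 2 * L := by
        rw [hε, mul_add, ← mul_assoc l (M * √W), h1, ← sq, h2]; ring
      rw [h4, this]; ring
    rw [← hW, h5, Real.exp_add, ENNReal.ofReal_mul (Real.exp_pos _).le, mul_assoc] at key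
    have h6 := (ENNReal.mul_le_mul_iff_right (by simp [Real.exp_pos]) ENNReal.ofReal_ne_top).1 key
    refine h6.trans (le_of_eq ?_)
    rw [Real.exp_neg, hL, Real.exp_log (by positivity), ← hN, ← ENNReal.ofReal_toReal hfin,
      ← ENNReal.ofReal_mul (by positivity), ENNReal.toReal_ofReal (by positivity)]
    congr 1
    field_simp

end Deviation

/-! ### Uniformity over scales and conclusion. -/

/-- If each of the nested events `{b i < Φ x for some x}` has outer measure at most `c`, so has
their union. -/
lemma measure_exists_lt_le_of_forall {Ω ι κ : Type*} [MeasurableSpace Ω] {μ : Measure Ω}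
    {c : ℝ≥0∞} (b : ι → ℝ) (hb : BddBelow (Set.range b)) (Φ : κ → Ω → ℝ)
    (h : ∀ i, μ {ω | ∃ x, b i < Φ x ω} ≤ c) : μ {ω | ∃ i x, b i < Φ x ω} ≤ c := by
  rcases isEmpty_or_nonempty ι with hι | hι
  · simp
  set s : ℕ → Set Ω := fun n => {ω | ∃ x, (⨅ i, b i) + 1 / ((n : ℝ) + 1) < Φ x ω}
  have hs : Monotone s := by
    rintro m n hmn ω ⟨x, hx⟩
    refine ⟨x, lt_of_le_of_lt ?_ hx⟩
    gcongr
  have hsub : {ω | ∃ i x, b i < Φ x ω} ⊆ ⋃ n, s n := by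
    rintro ω ⟨i, x, hx⟩
    obtain ⟨n, hn⟩ := exists_nat_one_div_lt (sub_pos.2 hx)
    refine Set.mem_iUnion.2 ⟨n, x, ?_⟩
    have := ciInf_le hb i
    linarith
  -- The union is exhausted by a countable increasing sequence of events, each inside one of the
  -- given ones, so continuity from below replaces a union bound.
  refine (measure_mono hsub).trans ?_
  rw [hs.measure_iUnion]
  refine iSup_le fun n => ?_
  obtain ⟨i, hi⟩ := exists_lt_of_ciInf_lt
    (lt_add_of_pos_right (⨅ i, b i) (Nat.one_div_pos_of_nat (n := n) (α := ℝ)))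
  exact (measure_mono fun ω (hω : ∃ x, _ < Φ x ω) => hω.imp fun x hx => hi.trans hx).trans (h i)

theorem theorem9
    {Ω X Y : Type*} [MeasurableSpace Ω] [MeasurableSpace X] [MeasurableSpace Y]
    (μ : Measure Ω) [IsProbabilityMeasure μ]
    -- the observed process and its conditional distributions given the past
    (T : ℕ) (Z : Fin T → Ω → X × Y) (hZ : ∀ t, Measurable (Z t))
    (P : (k : ℕ) → Kernel (Fin k → X × Y) (X × Y)) [∀ k, IsMarkovKernel (P k)]
    (hP : ∀ t : Fin T, HasCondDistrib (Z t) (past Z t) (P t) μ)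
    -- the bounded loss and the hypothesis set
    (L : Y → Y → ℝ) (hL : ∀ y y', 0 ≤ L y y')
    (H : Set (X → Y)) (hH : H.Nonempty)
    (M : ℝ) (hM : ∀ f ∈ lossClass L H, ∀ z, |f z| ≤ M)
    (hF : IsMeasurableClass (lossClass L H))
    -- the weights
    (q : Fin T → ℝ) (s : ℕ) (hs : 1 ≤ s) (hsT : s ≤ T)
    (δ : ℝ) (hδ : 0 < δ) :
    ∃ E : Set Ω, MeasurableSet E ∧ 1 - δ ≤ μ.real E ∧ ∀ ω ∈ E, ∀ α : ℝ, 0 < α →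
      expectedSeqCoveringNumber P (fun t => uniformLast T s t - q t) α (lossClass L H) ≠ ⊤ →
      (⨆ f : lossClass L H,
          ∑ t, (uniformLast T s t - q t) * ∫ z, f.1 z ∂(P t (past Z t ω)))
        ≤ (⨆ f : lossClass L H, ∑ t, (uniformLast T s t - q t) * f.1 (Z t ω))
          + (2 * α
            + M * √(∑ t, (q t - uniformLast T s t) ^ 2)
              * √(2 * Real.log
                  ((expectedSeqCoveringNumber P (fun t => uniformLast T s t - q t) α
                    (lossClass L H)).toReal / δ))) := by
  rcases le_or_gt 1 δ with hδ1 | hδ1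
  -- For `δ ≥ 1` the empty event already has the required probability.
  · exact ⟨∅, MeasurableSet.empty, by simpa using hδ1, fun ω hω => hω.elim⟩
  set F := lossClass L H with hFdef
  set w : Fin T → ℝ := fun t => uniformLast T s t - q t with hw
  have hne : F.Nonempty := hH.image _
  have h0 : ∀ g ∈ F, ∀ x, 0 ≤ g x := by
    rintro _ ⟨h, -, rfl⟩ x
    exact hL _ _
  obtain ⟨ω₀⟩ : Nonempty Ω := nonempty_of_isProbabilityMeasure μ
  set a₀ : X × Y := Z ⟨0, by omega⟩ ω₀
  have hM0 : 0 ≤ M := by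
    obtain ⟨f, hf⟩ := hne
    exact (abs_nonneg _).trans (hM f hf a₀)
  -- The process is continued by the constant `a₀` from time `T` on, so that histories of every
  -- length exist; only times below `T` enter the bound.
  set Z' : ℕ → Ω → X × Y := fun i => if h : i < T then Z ⟨i, h⟩ else fun _ => a₀ with hZ'
  have hZ'm : ∀ i, Measurable (Z' i) := by
    intro i
    by_cases h : i < T
    · simpa [hZ', h] using hZ ⟨i, h⟩
    · simp [hZ', h]
  have hZ't : ∀ t : Fin T, Z' t = Z t := fun t => by simp [hZ']
  have hpast : ∀ t : Fin T, history Z' t = past Z t := by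
    intro t
    funext ω i
    have h : (i : ℕ) < T := i.isLt.trans t.isLt
    simp only [history, past, hZ', h, dif_pos]
    rfl
  have hP' : ∀ k < T, HasCondDistrib (Z' k) (history Z' k) (P k) μ := by
    intro k hk
    have h := hP ⟨k, hk⟩
    rwa [← hZ't, ← hpast] at h
  have hW : ∑ t, (q t - uniformLast T s t) ^ 2 = ∑ t, w t ^ 2 :=
    Finset.sum_congr rfl fun t _ => by simp only [hw]; ring
  set b : {α : ℝ // 0 < α ∧ expectedSeqCoveringNumber P w α F ≠ ⊤} → ℝ := fun α =>
    2 * α.1 + M * √(∑ t, w t ^ 2) *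
      √(2 * Real.log ((expectedSeqCoveringNumber P w α.1 F).toReal / δ)) with hb
  set Φ : F → Ω → ℝ := fun f ω =>
    ∑ t : Fin T, w t * (∫ x, f.1 x ∂P t (history Z' t ω) - f.1 (Z' t ω)) with hΦ
  set B : Set Ω := {ω | ∃ α f, b α < Φ f ω} with hB
  have hμB : μ B ≤ ENNReal.ofReal δ := by
    refine measure_exists_lt_le_of_forall b ⟨0, ?_⟩ Φ fun α => ?_
    · rintro _ ⟨α, rfl⟩
      have := α.2.1
      positivity
    · refine (measure_mono ?_).trans (measure_exists_deviation_le_ofReal (μ := μ) hZ'm hP' hF hne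
        h0 hM hM0 w α.2.1 hδ hδ1 α.2.2)
      rintro ω ⟨f, hf⟩
      exact ⟨f.1, f.2, hf⟩
  -- The bad event need not be measurable; its measurable hull has the same measure.
  refine ⟨(toMeasurable μ B)ᶜ, (measurableSet_toMeasurable _ _).compl, ?_, ?_⟩
  · rw [probReal_compl_eq_one_sub (measurableSet_toMeasurable _ _)]
    have : μ.real (toMeasurable μ B) ≤ δ := by
      rw [measureReal_def, measure_toMeasurable]
      exact ENNReal.toReal_le_of_le_ofReal hδ.le hμB
    linarith
  · intro ω hω α hα hfin
    have hωB : ω ∉ B := fun h => hω (subset_toMeasurable _ _ h)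
    have : Nonempty F := hne.to_subtype
    rw [hW]
    refine ciSup_le fun f => ?_
    have h1 : Φ f ω ≤ b ⟨α, hα, hfin⟩ := by
      by_contra h
      exact hωB ⟨⟨α, hα, hfin⟩, f, not_le.1 h⟩
    have h2 : ∑ t, w t * f.1 (Z t ω) ≤ ⨆ f : F, ∑ t, w t * f.1 (Z t ω) :=
      le_ciSup (bddAbove_weightedSum hM w fun t => Z t ω) f
    have h3 : Φ f ω = ∑ t, w t * ∫ z, f.1 z ∂(P t (past Z t ω)) - ∑ t, w t * f.1 (Z t ω) := by
      simp only [hΦ, hZ't, hpast, mul_sub, Finset.sum_sub_distrib]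
    simp only [hb] at h1
    linarith
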